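/- Let $A$ be a commutative ring, let $\mathtt p=X^n+c_1X^{n-1}+\dots+c_n\in A[X]$ be a monic polynomial of degree $n$, and let $0\le k\le n$. Put $M=XA[X]$ and $M(\mathtt p)=M/\mathtt pM$, so that $M=M(0)$, and write $\epsilon^i$ ($i\ge 1$) for the class of $X^i$. For $\mathtt r\in\{0,\mathtt p\}$ let $D_t=\sum_{h\ge 0}D_ht^h:\bigwedge M(\mathtt r)\to(\bigwedge M(\mathtt r))[[t]]$ be the canonical derivation, i.e. the unique $A$-algebra homomorphism with $D_h\epsilon^i=\epsilon^{i+h}$ for all $h\ge 0$, $i\ge 1$. Each $D_h$ maps $\bigwedge^kM(\mathtt r)$ to itself; let $\mathcal A^*(\bigwedge^kM(\mathtt r))\subseteq \mathrm{End}_A(\bigwedge^kM(\mathtt r))$ be the $A$-subalgebra generated by the restrictions of all $D_1,D_2,\dots$ to $\bigwedge^kM(\mathtt r)$. In the polynomial ring $A[T_1,\dots,T_k]$ put $T_0=1$, $T_m=0$ for $m<0$, and $\Delta_h=\det(T_{j+1-i})_{1\le i,j\le h}$ for $0\le h\le k$ (so $\Delta_0=1$). Define $\widetilde D_j\in A[T_1,\dots,T_k]$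 by $$\sum_{j\ge 0}\widetilde D_j\,t^j=\frac1{1-\Delta_1t+\Delta_2t^2-\dots+(-1)^k\Delta_kt^k},$$ and for $n-k+1\le m\le n$ put $$\widetilde D_m(\mathtt p)=\widetilde D_m+\sum_{i=1}^{m}c_i\,\widetilde D_{m-i}.$$ Then: 1. $D_1,\dots,D_k$ are algebraically independent generators of $\mathcal A^*(\bigwedge^kM)$: there is an $A$-algebra isomorphism $A[T_1,\dots,T_k]\cong\mathcal A^*(\bigwedge^kM)$ with $T_i\mapsto D_i$ $(1\le i\le k)$. Thus $\mathcal A^*(\bigwedge^kM)=A[D_1,\dots,D_k]$ is a polynomial ring. 2. There is an $A$-algebra isomorphism $$\frac{A[T_1,\dots,T_k]}{\big(\widetilde D_{n-k+1}(\mathtt p),\dots,\widetilde D_n(\mathtt p)\big)}\;\cong\;\mathcal A^*\Big(\bigwedge^kM(\mathtt p)\Big)$$ sending the class of $T_i$ to $D_i$ for $1\le i\le k$. In particular $\mathcal A^*(\bigwedge^kM(\mathtt p))$ is generated by $D_1,\dots,D_k$. -/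

import Mathlib

open Polynomial

noncomputable section

namespace SchubertCalculus

/-- The `A[X]`-module `M(p) = M / pM`, where `M = X A[X]` is the ideal of `A[X]` generated by `X`.
It is regarded as an `A`-module by restriction of scalars.  For `p = 0` this is `M` itself. -/
abbrev ModP {A : Type*} [CommRing A] (p : A[X]) : Type _ :=
  QuotSMulTop p (Ideal.span {(X : A[X])} : Ideal A[X])

/-- The class `ε^i` of `X ^ i` in `M(p)`, for `i ≥ 1`. -/
def eps {A : Type*} [CommRing A] (p : A[X]) (i : ℕ) (hi : 1 ≤ i) : ModP p :=
  Submodule.Quotient.mk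
    ⟨(X : A[X]) ^ i, Ideal.mem_span_singleton.2 (dvd_pow_self X (Nat.one_le_iff_ne_zero.1 hi))⟩

section Derivation

variable (A N : Type*) [CommRing A] [AddCommGroup N] [Module A N] [Module A[X] N]
  [IsScalarTower A A[X] N]

/-- The `A`-linear map `N → (⋀ N)[[t]]`, `m ↦ ∑_h (X ^ h m) t ^ h`. -/
def genSeries : N →ₗ[A] PowerSeries (ExteriorAlgebra A N) where
  toFun m := PowerSeries.mk fun h => ExteriorAlgebra.ι A ((X : A[X]) ^ h • m)
  map_add' m m' := by
    ext h
    simp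
  map_smul' a m := by
    ext h
    simp [smul_comm _ a m]

theorem genSeries_mul_self (m : N) : genSeries A N m * genSeries A N m = 0 := by
  ext h
  rw [PowerSeries.coeff_mul, map_zero]
  simp only [genSeries, LinearMap.coe_mk, AddHom.coe_mk, PowerSeries.coeff_mk]
  refine Finset.sum_involution (fun x _ => x.swap) ?_ ?_ ?_ ?_
  · intro x _
    exact ExteriorAlgebra.ι_add_mul_swap _ _
  · rintro ⟨a, b⟩ _ hne heq
    simp only [Prod.swap_prod_mk, Prod.mk.injEq] at heq
    apply hne
    simp [heq.1]
  · intro x hx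
    simpa [add_comm] using hx
  · intro x _
    exact Prod.swap_swap x

/-- The canonical derivation `D_t = ∑_h D_h t ^ h : ⋀ N → (⋀ N)[[t]]` of an `A[X]`-module `N`:
the unique `A`-algebra homomorphism which on `N` is `m ↦ ∑_h (X ^ h m) t ^ h`.  For `N = M(p)`
this means `ε^i ↦ ∑_h ε^{i+h} t ^ h`, see `D_eps` below. -/
def derivationSeries :
    ExteriorAlgebra A N →ₐ[A] PowerSeries (ExteriorAlgebra A N) :=
  ExteriorAlgebra.lift A ⟨genSeries A N, genSeries_mul_self A N⟩

/-- The component `D_h` of the canonical derivation, an `A`-endomorphism of `⋀ N`. -/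
def D (h : ℕ) : Module.End A (ExteriorAlgebra A N) where
  toFun α := PowerSeries.coeff h (derivationSeries A N α)
  map_add' α β := by simp
  map_smul' a α := by simp

theorem D_ι (h : ℕ) (m : N) :
    D A N h (ExteriorAlgebra.ι A m) = ExteriorAlgebra.ι A ((X : A[X]) ^ h • m) := by
  simp [D, derivationSeries, genSeries]

/-- Leibniz's rule of order `h`. -/
theorem D_mul (h : ℕ) (α β : ExteriorAlgebra A N) :
    D A N h (α * β) = ∑ x ∈ Finset.HasAntidiagonal.antidiagonal h, D A N x.1 α * D A N x.2 β := by
  simp [D, PowerSeries.coeff_mul]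

theorem D_mem (k h : ℕ) : ∀ α ∈ ⋀[A]^k N, D A N h α ∈ ⋀[A]^k N := by
  induction k generalizing h with
  | zero =>
    intro α hα
    rw [ExteriorAlgebra.exteriorPower, pow_zero, Submodule.mem_one] at hα ⊢
    obtain ⟨a, rfl⟩ := hα
    refine ⟨if h = 0 then a else 0, ?_⟩
    simp only [D, LinearMap.coe_mk, AddHom.coe_mk, AlgHom.commutes, PowerSeries.algebraMap_apply,
      PowerSeries.coeff_C]
    split_ifs <;> simp
  | succ k ih =>
    intro α hα
    rw [ExteriorAlgebra.exteriorPower, pow_succ] at hα ⊢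
    induction hα using Submodule.mul_induction_on' with
    | mem_mul_mem a ha b hb =>
      obtain ⟨m, rfl⟩ := hb
      rw [D_mul]
      refine Submodule.sum_mem _ fun x _ => Submodule.mul_mem_mul (ih _ _ ha) ?_
      exact ⟨_, (D_ι A N x.2 m).symm⟩
    | add a _ b _ h1 h2 =>
      rw [map_add]
      exact Submodule.add_mem _ h1 h2

/-- The restriction of `D_h` to the exterior power `⋀^k N`. -/
def DRes (k h : ℕ) : Module.End A (⋀[A]^k N) :=
  (D A N h).restrict (D_mem A N k h)

end Derivation

/-- The initial conditions `D_h ε^i = ε^{i+h}`. -/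
theorem D_eps {A : Type*} [CommRing A] (p : A[X]) (h i : ℕ) (hi : 1 ≤ i) :
    D A (ModP p) h (ExteriorAlgebra.ι A (eps p i hi)) =
      ExteriorAlgebra.ι A (eps p (i + h) (le_add_right hi)) := by
  rw [D_ι]
  congr 1
  rw [eps, eps, ← Submodule.Quotient.mk_smul]
  congr 1
  ext1
  simp [pow_add, mul_comm]

/-- The ring `𝒜^*(⋀^k M(p))` of all polynomial expressions, with coefficients in `A`, in the
restrictions to `⋀^k M(p)` of all the operators `D_1, D_2, …` (restriction being multiplicative,
this is the ring of restrictions of all polynomial expressions in the `D_h` on `⋀ M(p)`). -/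
def OperatorRing {A : Type*} [CommRing A] (p : A[X]) (k : ℕ) :
    Subalgebra A (Module.End A (⋀[A]^k (ModP p))) :=
  Algebra.adjoin A {f | ∃ h, 1 ≤ h ∧ f = DRes A (ModP p) k h}

section Relations

/-- The Schur determinant `Δ_I(T) = det (T_{i_j - i})_{1 ≤ i, j ≤ l}` for `I = (i_1, …, i_l)`.
Columns are numbered from `0` here, so `I j` is `i_{j+1}`. -/
def schurDet {R : Type*} [CommRing R] (T : ℤ → R) {l : ℕ} (I : Fin l → ℕ) : R :=
  Matrix.det (Matrix.of fun i j : Fin l => T ((I j : ℤ) - ((i : ℕ) + 1)))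

variable (A : Type*) [CommRing A]

/-- The indeterminates of `A[T_1, …, T_k]`, with `T_0 = 1` and `T_m = 0` for `m < 0` (and also
for `m > k`, which never occurs below).  The indeterminate `T_m` is `X (m - 1)`. -/
def indet (k : ℕ) (m : ℤ) : MvPolynomial (Fin k) A :=
  if m = 0 then 1
  else if h : 1 ≤ m ∧ m ≤ k then MvPolynomial.X ⟨(m - 1).toNat, by omega⟩
  else 0

/-- The power series `1 - Δ_(2)(T) t + Δ_(2,3)(T) t^2 - … + (-1)^k Δ_(2,…,k+1)(T) t^k`. -/
def denomSeries (k : ℕ) : PowerSeries (MvPolynomial (Fin k) A) :=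
  PowerSeries.mk fun h =>
    if h ≤ k then (-1) ^ h * schurDet (indet A k) (fun j : Fin h => (j : ℕ) + 2) else 0

/-- The polynomial `D̃_j(T_1, …, T_k)`: the coefficient of `t ^ j` in the inverse of
`denomSeries` (a series with constant coefficient `1`). -/
def Dtilde (k j : ℕ) : MvPolynomial (Fin k) A :=
  PowerSeries.coeff j (PowerSeries.invOfUnit (denomSeries A k) 1)

theorem denomSeries_mul_inv (k : ℕ) :
    denomSeries A k * PowerSeries.invOfUnit (denomSeries A k) 1 = 1 := by
  apply PowerSeries.mul_invOfUnit
  simp [denomSeries, schurDet, ← PowerSeries.coeff_zero_eq_constantCoeff_apply]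

variable {A}

/-- The coefficient `c_i` of `p = X ^ n + c_1 X ^ (n-1) + … + c_n`, with `c_i = 0` for `i > n`. -/
def lowCoeff (p : A[X]) (i : ℕ) : A :=
  if i ≤ p.natDegree then p.coeff (p.natDegree - i) else 0

/-- `D̃_m(T_1, …, T_k; p) = D̃_m + ∑_{i=1}^m c_i D̃_{m-i}`. -/
def DtildeP (p : A[X]) (k m : ℕ) : MvPolynomial (Fin k) A :=
  Dtilde A k m + ∑ i ∈ Finset.Icc 1 m, MvPolynomial.C (lowCoeff p i) * Dtilde A k (m - i)

/-- The ideal of `A[T_1, …, T_k]` generated by `D̃_{n-k+1}(p), …, D̃_n(p)`, where `n` is the degree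
of `p` and `k ≤ n`. -/
def relIdeal (p : A[X]) (k : ℕ) : Ideal (MvPolynomial (Fin k) A) :=
  Ideal.span {f | ∃ j, 1 ≤ j ∧ j ≤ k ∧ f = DtildeP p k (p.natDegree - k + j)}

end Relations

end SchubertCalculus

end

noncomputable section

namespace SchubertCalculus

/-! ### The derivation `D_t` and its inverse `E_t` -/

section Operators

/-! Let `opEval` be the evaluation T_i ↦ D_i on ⋀^k; everything reduces to its image and its kernel.

Image: D_t acts on N as 1/(1 - Xt), so its inverse E_t acts as 1 - Xt and has degree at most k in t
on ⋀^k. Through degree k, the determinants Δ_i and the components of E_t are computed from D_1, …,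
D_k by the same recursion. Hence 1 - Δ_1 t + … ± Δ_k t^k acts as E_t, and inverting gives D̃_h ↦ D_h
for every h (`opEval_Dtilde`). So `opEval` is surjective.

Kernel: let N be spanned by the X^i g and put w = g ∧ Xg ∧ … ∧ X^(k-1)g. Integration by parts
generates ⋀^k N from w by the D_h, so a commuting operator is zero once it kills w
(`opRing_eq_zero`). Since D_h only raises the last factor of w by h, D̃_m(p) sends w to (g ∧ … ∧
X^(k-2)g) ∧ X^j p g = 0 for a suitable j (`relIdeal_le_ker`).

Conversely, let ψ : A[T] → S be such that e = X^k - ψ(Δ_1) X^(k-1) + … ± ψ(Δ_k) divides p over S.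
Then M(p) maps to S[X]/(e), where 1 ∧ X ∧ … ∧ X^(k-1) has no annihilator and D_h multiplies it by
ψ(D̃_h). So `opEval` f = 0 forces ψ f = 0 (`eq_zero_of_opEval_eq_zero`). For p = 0 take ψ = id, as
everything divides 0. For monic p take the quotient map modulo the relations, which express exactly
what this division needs (`factorPoly_dvd`). -/

theorem sum_antidiagonal_interchange {R : Type*} [AddCommMonoid R] (h : ℕ)
    (f : ℕ → ℕ → ℕ → ℕ → R) :
    ∑ x ∈ Finset.HasAntidiagonal.antidiagonal h, ∑ y ∈ Finset.HasAntidiagonal.antidiagonal x.2,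
        ∑ z ∈ Finset.HasAntidiagonal.antidiagonal x.1, f z.1 z.2 y.1 y.2 =
      ∑ x ∈ Finset.HasAntidiagonal.antidiagonal h, ∑ y ∈ Finset.HasAntidiagonal.antidiagonal x.1,
        ∑ z ∈ Finset.HasAntidiagonal.antidiagonal x.2, f y.1 z.1 y.2 z.2 := by
  simp only [Finset.sum_sigma']
  refine Finset.sum_nbij'
    (fun x => ⟨(x.2.2.1 + x.2.1.1, x.2.2.2 + x.2.1.2), (x.2.2.1, x.2.1.1), (x.2.2.2, x.2.1.2)⟩)
    (fun x => ⟨(x.2.1.1 + x.2.2.1, x.2.1.2 + x.2.2.2), (x.2.1.2, x.2.2.2), (x.2.1.1, x.2.2.1)⟩)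
    ?_ ?_ ?_ ?_ ?_
  · rintro ⟨⟨a, b⟩, ⟨c, d⟩, ⟨e, f⟩⟩ hx
    simp only [Finset.mem_sigma, Finset.HasAntidiagonal.mem_antidiagonal] at hx ⊢
    exact ⟨by omega, trivial, trivial⟩
  · rintro ⟨⟨a, b⟩, ⟨c, d⟩, ⟨e, f⟩⟩ hx
    simp only [Finset.mem_sigma, Finset.HasAntidiagonal.mem_antidiagonal] at hx ⊢
    exact ⟨by omega, trivial, trivial⟩
  · rintro ⟨⟨a, b⟩, ⟨c, d⟩, ⟨e, f⟩⟩ hx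
    simp only [Finset.mem_sigma, Finset.HasAntidiagonal.mem_antidiagonal] at hx ⊢
    obtain ⟨_, rfl, rfl⟩ := hx
    rfl
  · rintro ⟨⟨a, b⟩, ⟨c, d⟩, ⟨e, f⟩⟩ hx
    simp only [Finset.mem_sigma, Finset.HasAntidiagonal.mem_antidiagonal] at hx ⊢
    obtain ⟨_, rfl, rfl⟩ := hx
    rfl
  · intro x _
    rfl

variable (A N : Type*) [CommRing A] [AddCommGroup N] [Module A N] [Module A[X] N]
  [IsScalarTower A A[X] N]

theorem D_algebraMap (h : ℕ) (a : A) :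
    D A N h (algebraMap A _ a) = if h = 0 then algebraMap A _ a else 0 := by
  simp only [D, LinearMap.coe_mk, AddHom.coe_mk, AlgHom.commutes, PowerSeries.algebraMap_apply,
    PowerSeries.coeff_C]

theorem D_one (h : ℕ) : D A N h 1 = if h = 0 then 1 else 0 := by
  simpa using D_algebraMap A N h 1

theorem D_zero_apply (α : ExteriorAlgebra A N) : D A N 0 α = α := by
  induction α using ExteriorAlgebra.induction with
  | algebraMap a => simp [D_algebraMap]
  | ι m => simp [D_ι]
  | mul a b ha hb => simp [D_mul, ha, hb]
  | add a b ha hb => rw [map_add, ha, hb]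

theorem D_comm (h l : ℕ) (α : ExteriorAlgebra A N) :
    D A N h (D A N l α) = D A N l (D A N h α) := by
  induction α using ExteriorAlgebra.induction generalizing h l with
  | algebraMap a => simp only [D_algebraMap]; split_ifs <;> simp_all [D_algebraMap]
  | ι m => simp only [D_ι, smul_smul, ← pow_add, add_comm]
  | mul a b ha hb =>
    simp only [D_mul, map_sum]
    rw [Finset.sum_comm]
    simp only [ha, hb]
  | add a b ha hb => simp only [map_add, ha, hb]

/-- The `A`-linear map `N → (⋀ N)[[t]]`, `m ↦ m - (X m) t`. -/
def linSeries : N →ₗ[A] PowerSeries (ExteriorAlgebra A N) where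
  toFun m := PowerSeries.C (ExteriorAlgebra.ι A m) -
    PowerSeries.X * PowerSeries.C (ExteriorAlgebra.ι A ((X : A[X]) • m))
  map_add' m m' := by
    simp only [smul_add, map_add, mul_add]
    abel
  map_smul' a m := by
    ext (_ | h) <;> simp [smul_comm _ a m, smul_sub]

theorem linSeries_mul_self (m : N) : linSeries A N m * linSeries A N m = 0 := by
  simp only [linSeries, LinearMap.coe_mk, AddHom.coe_mk]
  set a := ExteriorAlgebra.ι A m
  set b := ExteriorAlgebra.ι A ((X : A[X]) • m)
  have h1 : a * a = 0 := ExteriorAlgebra.ι_sq_zero m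
  have h2 : b * b = 0 := ExteriorAlgebra.ι_sq_zero _
  have h3 : a * b + b * a = 0 := ExteriorAlgebra.ι_add_mul_swap _ _
  have hX : ∀ c : ExteriorAlgebra A N,
      PowerSeries.C c * PowerSeries.X = PowerSeries.X * PowerSeries.C c :=
    fun c => PowerSeries.X_mul.symm
  have hX2 : ∀ c d : ExteriorAlgebra A N, PowerSeries.C c * (PowerSeries.X * PowerSeries.C d) =
      PowerSeries.X * PowerSeries.C (c * d) := fun c d => by
    rw [← mul_assoc, hX, mul_assoc, map_mul]
  simp only [sub_mul, mul_sub, mul_assoc, hX2, ← map_mul]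
  rw [h1, h2, eq_neg_of_add_eq_zero_left h3]
  simp

/-- The inverse of the canonical derivation: the algebra homomorphism `⋀ N → (⋀ N)[[t]]`
which on `N` is `m ↦ m - (X m) t`. -/
def inverseSeries : ExteriorAlgebra A N →ₐ[A] PowerSeries (ExteriorAlgebra A N) :=
  ExteriorAlgebra.lift A ⟨linSeries A N, linSeries_mul_self A N⟩

/-- The component of degree `h` of the inverse of the canonical derivation. -/
def E (h : ℕ) : Module.End A (ExteriorAlgebra A N) where
  toFun α := PowerSeries.coeff h (inverseSeries A N α)
  map_add' α β := by simp
  map_smul' a α := by simp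

theorem E_algebraMap (h : ℕ) (a : A) :
    E A N h (algebraMap A _ a) = if h = 0 then algebraMap A _ a else 0 := by
  simp only [E, LinearMap.coe_mk, AddHom.coe_mk, AlgHom.commutes, PowerSeries.algebraMap_apply,
    PowerSeries.coeff_C]

theorem E_ι_zero (m : N) : E A N 0 (ExteriorAlgebra.ι A m) = ExteriorAlgebra.ι A m := by
  simp [E, inverseSeries, linSeries]

theorem E_ι_one (m : N) :
    E A N 1 (ExteriorAlgebra.ι A m) = -ExteriorAlgebra.ι A ((X : A[X]) • m) := by
  simp [E, inverseSeries, linSeries]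

theorem E_ι_add_two (h : ℕ) (m : N) : E A N (h + 2) (ExteriorAlgebra.ι A m) = 0 := by
  simp [E, inverseSeries, linSeries, PowerSeries.coeff_X]

theorem E_mul (h : ℕ) (α β : ExteriorAlgebra A N) :
    E A N h (α * β) = ∑ x ∈ Finset.HasAntidiagonal.antidiagonal h, E A N x.1 α * E A N x.2 β := by
  simp [E, PowerSeries.coeff_mul]

/-- Each of the k factors of a wedge contributes at most one power of t. This bound is why k
generators suffice. -/
theorem E_eq_zero_of_lt (k : ℕ) :
    ∀ h, k < h → ∀ α ∈ ⋀[A]^k N, E A N h α = 0 := by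
  induction k with
  | zero =>
    intro h hh α hα
    rw [ExteriorAlgebra.exteriorPower, pow_zero, Submodule.mem_one] at hα
    obtain ⟨a, rfl⟩ := hα
    rw [E_algebraMap, if_neg hh.ne']
  | succ k ih =>
    intro h hh α hα
    rw [ExteriorAlgebra.exteriorPower, pow_succ] at hα
    induction hα using Submodule.mul_induction_on' with
    | mem_mul_mem a ha b hb =>
      obtain ⟨m, rfl⟩ := hb
      rw [E_mul]
      refine Finset.sum_eq_zero fun x hx => ?_
      obtain ⟨i, j⟩ := x
      rw [Finset.HasAntidiagonal.mem_antidiagonal] at hx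
      dsimp only at hx ⊢
      by_cases hi : k < i
      · rw [ih i hi a ha, zero_mul]
      · obtain ⟨j, rfl⟩ : ∃ j', j = j' + 2 := ⟨j - 2, by omega⟩
        rw [E_ι_add_two, mul_zero]
    | add a _ b _ h1 h2 => rw [map_add, h1, h2, add_zero]

/-- Both series are multiplicative, so it suffices to check generators, where (1 - Xt) · 1/(1 - Xt)
= 1; only two terms survive there and they cancel. -/
theorem sum_E_D (h : ℕ) (α : ExteriorAlgebra A N) :
    ∑ x ∈ Finset.HasAntidiagonal.antidiagonal h, E A N x.1 (D A N x.2 α) =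
      if h = 0 then α else 0 := by
  induction α using ExteriorAlgebra.induction generalizing h with
  | algebraMap a =>
    rcases h with _ | h
    · simp [D_algebraMap, E_algebraMap]
    · rw [if_neg (Nat.succ_ne_zero h)]
      refine Finset.sum_eq_zero fun x hx => ?_
      rw [Finset.HasAntidiagonal.mem_antidiagonal] at hx
      rw [D_algebraMap]
      split_ifs with h2
      · rw [E_algebraMap, if_neg (by omega)]
      · simp
  | ι m =>
    rcases h with _ | _ | h
    · simp [D_ι, E_ι_zero]
    · simp [Finset.Nat.antidiagonal_succ, D_ι, E_ι_zero, E_ι_one]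
    · simp [Finset.Nat.sum_antidiagonal_succ, D_ι, E_ι_zero, E_ι_one, E_ι_add_two, smul_smul,
        ← pow_succ']
  | mul a b ha hb =>
    have key : ∑ x ∈ Finset.HasAntidiagonal.antidiagonal h, E A N x.1 (D A N x.2 (a * b)) =
        ∑ x ∈ Finset.HasAntidiagonal.antidiagonal h,
          (∑ y ∈ Finset.HasAntidiagonal.antidiagonal x.1, E A N y.1 (D A N y.2 a)) *
          (∑ z ∈ Finset.HasAntidiagonal.antidiagonal x.2, E A N z.1 (D A N z.2 b)) := by
      simp only [D_mul, map_sum, E_mul, Finset.sum_mul_sum]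
      exact sum_antidiagonal_interchange h fun i j r s => E A N i (D A N r a) * E A N j (D A N s b)
    rw [key]
    simp only [ha, hb]
    rcases h with _ | h
    · simp
    · rw [if_neg (Nat.succ_ne_zero h)]
      refine Finset.sum_eq_zero fun x hx => ?_
      rw [Finset.HasAntidiagonal.mem_antidiagonal] at hx
      by_cases h1 : x.1 = 0
      · rw [if_neg (show x.2 ≠ 0 by omega), mul_zero]
      · rw [if_neg h1, zero_mul]
  | add a b ha hb =>
    simp only [map_add, Finset.sum_add_distrib, ha, hb]
    split_ifs <;> simp

end Operators

/-! ### The wedge g ∧ Xg ∧ … generates the exterior power -/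

section PowWedge

variable (A : Type*) {N : Type*} [CommRing A] [AddCommGroup N] [Module A N] [Module A[X] N]

/-- The wedge product `g ∧ X g ∧ … ∧ X ^ (j - 1) g`. -/
def powWedge (g : N) : ℕ → ExteriorAlgebra A N
  | 0 => 1
  | j + 1 => powWedge g j * ExteriorAlgebra.ι A ((X : A[X]) ^ j • g)

theorem powWedge_mem (g : N) (j : ℕ) : powWedge A g j ∈ ⋀[A]^j N := by
  induction j with
  | zero => simp [powWedge, ExteriorAlgebra.exteriorPower, Submodule.mem_one]
  | succ j ih =>
    rw [ExteriorAlgebra.exteriorPower, pow_succ]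
    exact Submodule.mul_mem_mul ih ⟨_, rfl⟩

theorem powWedge_mul_ι_of_lt (g : N) {i j : ℕ} (h : i < j) :
    powWedge A g j * ExteriorAlgebra.ι A ((X : A[X]) ^ i • g) = 0 := by
  induction j with
  | zero => omega
  | succ j ih =>
    rw [powWedge, mul_assoc]
    rcases Nat.lt_succ_iff_lt_or_eq.1 h with h | rfl
    · rw [eq_neg_of_add_eq_zero_left (ExteriorAlgebra.ι_add_mul_swap _ _), mul_neg, ← mul_assoc,
        ih h, zero_mul, neg_zero]
    · rw [ExteriorAlgebra.ι_sq_zero, mul_zero]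

variable [IsScalarTower A A[X] N]

/-- All Leibniz terms but one cancel, because the series of X^j g squares to zero. -/
theorem D_powWedge_succ (g : N) (h j : ℕ) :
    D A N h (powWedge A g (j + 1)) =
      powWedge A g j * ExteriorAlgebra.ι A ((X : A[X]) ^ (j + h) • g) := by
  induction j generalizing h with
  | zero => simp [powWedge, D_ι]
  | succ j ih =>
    -- The coefficient of t^(h+1) turns the Leibniz sum of X^(j+a) g ∧ X^(j+1+b) g over a + b = h
    -- into the single term X^j g ∧ X^(j+h+1) g.
    have hsq := congrArg (PowerSeries.coeff (h + 1)) (genSeries_mul_self A N ((X : A[X]) ^ j • g))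
    rw [PowerSeries.coeff_mul, map_zero, Finset.Nat.sum_antidiagonal_succ'] at hsq
    simp only [genSeries, LinearMap.coe_mk, AddHom.coe_mk, PowerSeries.coeff_mk, smul_smul,
      ← pow_add] at hsq
    rw [powWedge, D_mul]
    simp only [ih, D_ι, smul_smul, ← pow_add, mul_assoc]
    rw [← Finset.mul_sum]
    rw [powWedge, mul_assoc, show j + 1 + h = h + 1 + j by ring,
      eq_neg_of_add_eq_zero_left (ExteriorAlgebra.ι_add_mul_swap ((X : A[X]) ^ j • g) _),
      ← eq_neg_of_add_eq_zero_right (by simpa only [zero_add] using hsq)]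
    congr 1
    refine Finset.sum_congr rfl fun x _ => ?_
    rw [add_comm j x.1, show x.2 + (j + 1) = x.2 + 1 + j by ring]

/-- If `N` is spanned by the `X ^ i g`, a subspace of `⋀ N` stable under the `D_h` and containing
`g ∧ X g ∧ … ∧ X ^ (k - 1) g` contains `⋀^k N`. -/
theorem exteriorPower_le_of_powWedge_mem (g : N)
    (hg : Submodule.span A (Set.range fun i : ℕ => (X : A[X]) ^ i • g) = ⊤) (k : ℕ)
    (W : Submodule A (ExteriorAlgebra A N)) (hW : ∀ h, ∀ w ∈ W, D A N h w ∈ W)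
    (hk : powWedge A g k ∈ W) : ⋀[A]^k N ≤ W := by
  have key : ∀ d j, j + d = k → ∀ β ∈ ⋀[A]^d N, powWedge A g j * β ∈ W := by
    intro d
    induction d with
    | zero =>
      rintro j rfl β hβ
      rw [ExteriorAlgebra.exteriorPower, pow_zero, Submodule.mem_one] at hβ
      obtain ⟨a, rfl⟩ := hβ
      rw [← Algebra.commutes, ← Algebra.smul_def]
      exact W.smul_mem _ hk
    | succ d ih =>
      intro j hj β hβ
      have step : ∀ i, ∀ γ ∈ ⋀[A]^d N,
          powWedge A g j * ExteriorAlgebra.ι A ((X : A[X]) ^ i • g) * γ ∈ W := by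
        intro i
        induction i using Nat.strong_induction_on with
        | _ i hi =>
          intro γ hγ
          rcases lt_or_ge i j with hij | hij
          · rw [powWedge_mul_ι_of_lt A g hij, zero_mul]
            exact W.zero_mem
          · obtain ⟨s, rfl⟩ := Nat.exists_eq_add_of_le hij
            -- Integration by parts: D_s applied to `powWedge` (j + 1) ∧ γ gives the wanted element
            -- plus terms in which the exponent j + s is lowered and γ is differentiated.
            have h1 := hW s _ (ih (j + 1) (by omega) γ hγ)
            rw [D_mul] at h1
            simp only [D_powWedge_succ] at h1
            rw [← Finset.add_sum_erase _ _ (show (s, 0) ∈ Finset.HasAntidiagonal.antidiagonal s by simp),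
              D_zero_apply] at h1
            refine (W.add_mem_iff_left (W.sum_mem fun x hx => ?_)).1 h1
            rw [Finset.mem_erase, Finset.HasAntidiagonal.mem_antidiagonal, ne_eq, Prod.ext_iff] at hx
            exact hi _ (by simp only at hx; omega) _ (D_mem A N d _ γ hγ)
      rw [ExteriorAlgebra.exteriorPower, pow_succ'] at hβ
      induction hβ using Submodule.mul_induction_on' with
      | mem_mul_mem a ha b hb =>
        obtain ⟨m, rfl⟩ := ha
        have hm : m ∈ Submodule.span A (Set.range fun i : ℕ => (X : A[X]) ^ i • g) := by
          rw [hg]; trivial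
        induction hm using Submodule.span_induction with
        | mem x hx =>
          obtain ⟨i, rfl⟩ := hx
          rw [← mul_assoc]
          exact step i b hb
        | zero => simp
        | add x y _ _ hx hy =>
          rw [map_add, add_mul, mul_add]
          exact W.add_mem hx hy
        | smul a x _ hx =>
          rw [map_smul, smul_mul_assoc, mul_smul_comm]
          exact W.smul_mem _ hx
      | add a _ b _ h1 h2 =>
        rw [mul_add]
        exact W.add_mem h1 h2
  intro β hβ
  simpa [powWedge] using key k 0 (zero_add k) β hβ

end PowWedge

/-! ### Hessenberg determinants and the recursion for Δ_h -/

section Toeplitz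

variable {R : Type*} [CommRing R]

/-- The Hessenberg matrix of size `h + 1` with first row `T a, T (a + 1), …` and further rows
`T (j + 1 - i)`. -/
def hessenberg (T : ℤ → R) (h : ℕ) (a : ℤ) : Matrix (Fin (h + 1)) (Fin (h + 1)) R :=
  Matrix.of fun i j => if i = 0 then T (a + (j : ℕ)) else T ((j : ℕ) + 1 - (i : ℕ))

theorem det_hessenberg_one (T : ℤ → R) (h : ℕ) :
    (hessenberg T h 1).det = schurDet T (fun j : Fin (h + 1) => (j : ℕ) + 2) := by
  unfold schurDet hessenberg
  congr 1
  ext i j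
  simp only [Matrix.of_apply]
  split_ifs with hi
  · subst hi
    congr 1
    simp only [Fin.val_zero]
    push_cast
    ring
  · congr 1
    push_cast
    ring

theorem det_hessenberg_zero (T : ℤ → R) (a : ℤ) : (hessenberg T 0 a).det = T a := by
  simp [hessenberg]

/-- Expansion along the first column, which is (T a, 1, 0, …, 0). -/
theorem det_hessenberg_succ (T : ℤ → R) (h0 : T 0 = 1) (hneg : ∀ m < 0, T m = 0) (h : ℕ) (a : ℤ) :
    (hessenberg T (h + 1) a).det =
      T a * schurDet T (fun j : Fin (h + 1) => (j : ℕ) + 2) - (hessenberg T h (a + 1)).det := by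
  rw [Matrix.det_succ_column_zero, Fin.sum_univ_succ, Fin.sum_univ_succ, Finset.sum_eq_zero,
    add_zero, sub_eq_add_neg]
  · congr 1
    · have : (hessenberg T (h + 1) a).submatrix (Fin.succAbove 0) Fin.succ =
          Matrix.of fun i j : Fin (h + 1) => T ((((j : ℕ) + 2 : ℕ) : ℤ) - ((i : ℕ) + 1)) := by
        ext i j
        simp [hessenberg]
        congr 1
        ring
      rw [this]
      simp [hessenberg, schurDet]
    · have : (hessenberg T (h + 1) a).submatrix (Fin.succAbove (Fin.succ 0)) Fin.succ =
          hessenberg T h (a + 1) := by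
        ext i j
        refine Fin.cases ?_ (fun i => ?_) i
        · simp [hessenberg]
          congr 1
          ring
        · simp [hessenberg]
      rw [this]
      simp [hessenberg, h0]
  · intro i _
    have : hessenberg T (h + 1) a i.succ.succ 0 = 0 := by
      simp [hessenberg]
      apply hneg
      omega
    rw [this]
    simp

/-- The recursion between complete and elementary symmetric functions. -/
theorem sum_schurDet_mul (T : ℤ → R) (h0 : T 0 = 1) (hneg : ∀ m < 0, T m = 0) (h : ℕ) :
    ∑ x ∈ Finset.HasAntidiagonal.antidiagonal (h + 1),
      (-1) ^ x.1 * schurDet T (fun j : Fin x.1 => (j : ℕ) + 2) * T x.2 = 0 := by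
  -- The expansion shifts the first row, so the induction needs arbitrary a; at a = 1 the left side
  -- is itself Δ_(h+1).
  have key : ∀ (h : ℕ) (a : ℤ), (hessenberg T h a).det =
      (-1) ^ h * ∑ x ∈ Finset.HasAntidiagonal.antidiagonal h,
        (-1) ^ x.1 * schurDet T (fun j : Fin x.1 => (j : ℕ) + 2) * T (a + x.2) := by
    intro h
    induction h with
    | zero => intro a; rw [det_hessenberg_zero]; simp [schurDet]
    | succ h ih =>
      intro a
      rw [det_hessenberg_succ T h0 hneg, ih, Finset.Nat.sum_antidiagonal_succ']
      simp only [Nat.cast_add, Nat.cast_one, Nat.cast_zero, add_zero, add_assoc, add_comm (1 : ℤ)]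
      have hs : ((-1 : R) ^ (h + 1)) * (-1) ^ (h + 1) = 1 := by
        rw [← mul_pow]; simp
      linear_combination (-(schurDet T (fun j : Fin (h + 1) => (j : ℕ) + 2) * T a)) * hs
  have h1 := key h 1
  rw [det_hessenberg_one] at h1
  rw [Finset.Nat.sum_antidiagonal_succ']
  have hs : ((-1 : R) ^ h) * (-1) ^ h = 1 := by
    rw [← mul_pow]; simp
  simp only [Nat.cast_add, Nat.cast_one, Nat.cast_zero, add_comm _ (1 : ℤ), h0] at h1 ⊢
  rw [h1]
  linear_combination
    (-∑ x ∈ Finset.HasAntidiagonal.antidiagonal h,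
        (-1) ^ x.1 * schurDet T (fun j : Fin x.1 => (j : ℕ) + 2) * T (1 + x.2)) * hs

end Toeplitz

/-! ### The polynomials D̃_h -/

section Dtilde

variable (A : Type*) [CommRing A]

theorem coeff_denomSeries_zero (k : ℕ) : PowerSeries.coeff 0 (denomSeries A k) = 1 := by
  simp [denomSeries, schurDet]

theorem coeff_denomSeries_of_lt {k h : ℕ} (hh : k < h) :
    PowerSeries.coeff h (denomSeries A k) = 0 := by
  simp [denomSeries, hh]

theorem Dtilde_zero (k : ℕ) : Dtilde A k 0 = 1 := by
  simp [Dtilde]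

theorem sum_denom_mul_Dtilde (k h : ℕ) :
    ∑ x ∈ Finset.HasAntidiagonal.antidiagonal h,
      PowerSeries.coeff x.1 (denomSeries A k) * Dtilde A k x.2 = if h = 0 then 1 else 0 := by
  have := congrArg (PowerSeries.coeff h) (denomSeries_mul_inv A k)
  rwa [PowerSeries.coeff_mul, PowerSeries.coeff_one] at this

/-- Both sides satisfy the same recursion against (-1)^i Δ_i. It breaks off beyond k, where
`denomSeries` is truncated. -/
theorem Dtilde_eq_indet (k h : ℕ) (hh : h ≤ k) : Dtilde A k h = indet A k h := by
  induction h using Nat.strong_induction_on with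
  | _ h ih =>
    rcases h with _ | h
    · simp [Dtilde_zero, indet]
    · have h1 := sum_denom_mul_Dtilde A k (h + 1)
      have h2 := sum_schurDet_mul (indet A k) (by simp [indet])
        (fun m hm => by simp only [indet]; rw [if_neg (by omega), dif_neg (by omega)]) h
      rw [if_neg (Nat.succ_ne_zero h), Finset.Nat.sum_antidiagonal_succ, coeff_denomSeries_zero]
        at h1
      rw [Finset.Nat.sum_antidiagonal_succ] at h2
      have h3 : ∀ x ∈ Finset.HasAntidiagonal.antidiagonal h,
          PowerSeries.coeff (x.1 + 1) (denomSeries A k) * Dtilde A k x.2 =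
          (-1) ^ (x.1 + 1) * schurDet (indet A k) (fun j : Fin (x.1 + 1) => (j : ℕ) + 2) *
            indet A k x.2 := by
        intro x hx
        rw [Finset.HasAntidiagonal.mem_antidiagonal] at hx
        rw [ih x.2 (by omega) (by omega), denomSeries, PowerSeries.coeff_mk, if_pos (by omega)]
      rw [Finset.sum_congr rfl h3] at h1
      have h4 : schurDet (indet A k) (fun j : Fin 0 => (j : ℕ) + 2) = 1 := by simp [schurDet]
      simp only [h4, pow_zero, one_mul] at h1 h2
      exact add_right_cancel (h1.trans h2.symm)

theorem indet_succ (k : ℕ) (i : Fin k) : indet A k ((i : ℕ) + 1 : ℕ) = MvPolynomial.X i := by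
  simp only [indet]
  rw [if_neg (by omega), dif_pos (by omega)]
  congr 1
  ext
  simp

theorem Dtilde_succ (k : ℕ) (i : Fin k) : Dtilde A k ((i : ℕ) + 1) = MvPolynomial.X i := by
  rw [Dtilde_eq_indet A k _ i.isLt, indet_succ]

end Dtilde

/-- Evaluation of polynomials in an algebra whose multiplication is commutative. -/
def aevalOfComm {A B σ : Type*} [CommRing A] [Semiring B] [Algebra A B]
    (hB : ∀ b c : B, b * c = c * b) (x : σ → B) : MvPolynomial σ A →ₐ[A] B :=
  letI : CommSemiring B := { ‹Semiring B› with mul_comm := hB }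
  MvPolynomial.aeval x

theorem aevalOfComm_X {A B σ : Type*} [CommRing A] [Semiring B] [Algebra A B]
    (hB : ∀ b c : B, b * c = c * b) (x : σ → B) (i : σ) :
    aevalOfComm (A := A) hB x (MvPolynomial.X i) = x i := by
  let _ : CommSemiring B := { ‹Semiring B› with mul_comm := hB }
  unfold aevalOfComm
  exact MvPolynomial.aeval_X (R := A) x i

/-! ### The evaluation T_i ↦ D_i and its image -/

section OpRing

variable (A N : Type*) [CommRing A] [AddCommGroup N] [Module A N] [Module A[X] N]
  [IsScalarTower A A[X] N] (k : ℕ)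

/-- The algebra generated by the restrictions of `D_1, D_2, …` to `⋀^k N`. -/
abbrev opRing : Subalgebra A (Module.End A (⋀[A]^k N)) :=
  Algebra.adjoin A {f | ∃ h, 1 ≤ h ∧ f = DRes A N k h}

variable {k} in
theorem coe_DRes_apply (h : ℕ) (α : ⋀[A]^k N) :
    (DRes A N k h α : ExteriorAlgebra A N) = D A N h α := rfl

theorem DRes_zero : DRes A N k 0 = 1 := by
  refine LinearMap.ext fun α => ?_
  exact Subtype.ext (D_zero_apply A N α)

theorem DRes_comm (h l : ℕ) : DRes A N k h * DRes A N k l = DRes A N k l * DRes A N k h := by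
  refine LinearMap.ext fun α => ?_
  exact Subtype.ext (D_comm A N h l α)

theorem opRing_mul_comm (b c : opRing A N k) : b * c = c * b := by
  have := Algebra.isMulCommutative_adjoin A (s := {f | ∃ h, 1 ≤ h ∧ f = DRes A N k h}) (by
    rintro _ ⟨h, _, rfl⟩ _ ⟨l, _, rfl⟩
    exact DRes_comm A N k h l)
  exact mul_comm' b c

theorem DRes_mem (h : ℕ) : DRes A N k h ∈ opRing A N k := by
  rcases Nat.eq_zero_or_pos h with rfl | hh
  · rw [DRes_zero]
    exact one_mem _
  · exact Algebra.subset_adjoin ⟨h, hh, rfl⟩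

/-- The evaluation `T_i ↦ D_i`. -/
def opEval : MvPolynomial (Fin k) A →ₐ[A] opRing A N k :=
  aevalOfComm (opRing_mul_comm A N k)
    fun i : Fin k => (⟨DRes A N k (i + 1), DRes_mem A N k _⟩ : opRing A N k)

theorem opEval_X (i : Fin k) :
    (opEval A N k (MvPolynomial.X i) : Module.End A (⋀[A]^k N)) = DRes A N k (i + 1) := by
  rw [opEval, aevalOfComm_X]

theorem opEval_Dtilde_of_le {h : ℕ} (hh : h ≤ k) :
    (opEval A N k (Dtilde A k h) : Module.End A (⋀[A]^k N)) = DRes A N k h := by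
  rcases h with _ | h
  · simp [Dtilde_zero, DRes_zero]
  · rw [← opEval_X A N k ⟨h, hh⟩, ← Dtilde_succ]

theorem opEval_sum_mul_apply {ι : Type*} (s : Finset ι) (f g : ι → MvPolynomial (Fin k) A)
    (α : ⋀[A]^k N) :
    ((opEval A N k (∑ x ∈ s, f x * g x) : Module.End A (⋀[A]^k N)) α) =
      ∑ x ∈ s, (opEval A N k (f x) : Module.End A (⋀[A]^k N))
        ((opEval A N k (g x) : Module.End A (⋀[A]^k N)) α) := by
  simp [map_sum, LinearMap.sum_apply]

theorem sum_opEval_denom (h : ℕ) (α : ⋀[A]^k N) :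
    ∑ x ∈ Finset.HasAntidiagonal.antidiagonal h,
      (opEval A N k (PowerSeries.coeff x.1 (denomSeries A k)) : Module.End A (⋀[A]^k N))
        ((opEval A N k (Dtilde A k x.2) : Module.End A (⋀[A]^k N)) α) =
      if h = 0 then α else 0 := by
  rw [← opEval_sum_mul_apply, sum_denom_mul_Dtilde]
  split_ifs <;> simp

/-- Beyond k both sides vanish. Up to k, both are the left inverse of D_t, determined recursively by
D_1, …, D_k alone. -/
theorem opEval_denom (h : ℕ) (α : ⋀[A]^k N) :
    ((opEval A N k (PowerSeries.coeff h (denomSeries A k)) : Module.End A (⋀[A]^k N)) α :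
      ExteriorAlgebra A N) = E A N h α := by
  rcases lt_or_ge k h with hk | hk
  · rw [coeff_denomSeries_of_lt A hk, E_eq_zero_of_lt A N k h hk α α.2]
    simp
  induction h using Nat.strong_induction_on generalizing α with
  | _ h ih =>
    have h1 := congrArg (Subtype.val) (sum_opEval_denom A N k h α)
    have h2 := sum_E_D A N h (α : ExteriorAlgebra A N)
    have h3 : ((if h = 0 then α else 0 : ⋀[A]^k N) : ExteriorAlgebra A N) =
      if h = 0 then (α : ExteriorAlgebra A N) else 0 := by split_ifs <;> simp
    rw [h3, ← h2, AddSubmonoidClass.coe_finsetSum] at h1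
    rw [← Finset.add_sum_erase _ _
        (show (h, 0) ∈ Finset.HasAntidiagonal.antidiagonal h by simp),
      ← Finset.add_sum_erase _ (fun x : ℕ × ℕ => E A N x.1 (D A N x.2 (α : ExteriorAlgebra A N)))
        (show (h, 0) ∈ Finset.HasAntidiagonal.antidiagonal h by simp)] at h1
    rw [Finset.sum_congr rfl fun x hx => ?_] at h1
    · have h4 := add_right_cancel h1
      simpa [Dtilde_zero, D_zero_apply] using h4
    · rw [Finset.mem_erase, Finset.HasAntidiagonal.mem_antidiagonal, ne_eq, Prod.ext_iff] at hx
      simp only at hx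
      rw [ih x.1 (by omega) _ (by omega), opEval_Dtilde_of_le A N k (by omega), coe_DRes_apply]

/-- With `opEval_denom` in all degrees, D̃ and D solve the same recursion with coefficients E_i, now
without a bound on h. This expresses every D_h through D_1, …, D_k. -/
theorem opEval_Dtilde (h : ℕ) :
    (opEval A N k (Dtilde A k h) : Module.End A (⋀[A]^k N)) = DRes A N k h := by
  induction h using Nat.strong_induction_on with
  | _ h ih =>
    refine LinearMap.ext fun α => ?_
    apply Subtype.ext
    have h1 := congrArg (Subtype.val) (sum_opEval_denom A N k h α)
    have h2 := sum_E_D A N h (α : ExteriorAlgebra A N)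
    have h3 : ((if h = 0 then α else 0 : ⋀[A]^k N) : ExteriorAlgebra A N) =
      if h = 0 then (α : ExteriorAlgebra A N) else 0 := by split_ifs <;> simp
    rw [h3, ← h2, AddSubmonoidClass.coe_finsetSum] at h1
    simp only [opEval_denom] at h1
    rw [← Finset.add_sum_erase _ _
        (show (0, h) ∈ Finset.HasAntidiagonal.antidiagonal h by simp),
      ← Finset.add_sum_erase _ (fun x : ℕ × ℕ => E A N x.1 (D A N x.2 (α : ExteriorAlgebra A N)))
        (show (0, h) ∈ Finset.HasAntidiagonal.antidiagonal h by simp)] at h1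
    rw [Finset.sum_congr rfl fun x hx => ?_] at h1
    · have h4 := add_right_cancel h1
      rw [← opEval_denom, ← coe_DRes_apply, ← opEval_denom] at h4
      simpa [coeff_denomSeries_zero] using h4
    · rw [Finset.mem_erase, Finset.HasAntidiagonal.mem_antidiagonal, ne_eq, Prod.ext_iff] at hx
      simp only at hx
      rw [ih x.2 (by omega), coe_DRes_apply]

theorem opEval_surjective : Function.Surjective (opEval A N k) := by
  rintro ⟨b, hb⟩
  have h1 : opRing A N k ≤ ((opRing A N k).val.comp (opEval A N k)).range := by
    refine Algebra.adjoin_le ?_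
    rintro _ ⟨h, _, rfl⟩
    exact ⟨Dtilde A k h, opEval_Dtilde A N k h⟩
  obtain ⟨f, hf⟩ := h1 hb
  exact ⟨f, Subtype.ext hf⟩

/-- The operator ring is the quotient of the polynomial ring by the kernel of `opEval`. -/
theorem exists_quotient_equiv_opRing (I : Ideal (MvPolynomial (Fin k) A))
    (hI : ∀ f, f ∈ I ↔ opEval A N k f = 0) :
    ∃ Φ : (MvPolynomial (Fin k) A ⧸ I) ≃ₐ[A] opRing A N k, ∀ i : Fin k,
      (Φ (Ideal.Quotient.mk I (MvPolynomial.X i)) : Module.End A (⋀[A]^k N)) =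
        DRes A N k ((i : ℕ) + 1) := by
  refine ⟨AlgEquiv.ofBijective
    (Ideal.Quotient.liftₐ I (opEval A N k) fun f hf => (hI f).1 hf) ⟨?_, ?_⟩, opEval_X A N k⟩
  · refine (injective_iff_map_eq_zero _).2 fun x hx => ?_
    obtain ⟨f, rfl⟩ := Ideal.Quotient.mk_surjective x
    exact Ideal.Quotient.eq_zero_iff_mem.2 ((hI f).2 hx)
  · intro b
    obtain ⟨f, hf⟩ := opEval_surjective A N k b
    exact ⟨Ideal.Quotient.mk I f, hf⟩

/-- If `opEval` is injective, the operator ring is a polynomial ring. -/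
theorem exists_equiv_opRing (hI : ∀ f, opEval A N k f = 0 → f = 0) :
    ∃ Ψ : MvPolynomial (Fin k) A ≃ₐ[A] opRing A N k, ∀ i : Fin k,
      (Ψ (MvPolynomial.X i) : Module.End A (⋀[A]^k N)) = DRes A N k ((i : ℕ) + 1) :=
  ⟨AlgEquiv.ofBijective (opEval A N k)
    ⟨(injective_iff_map_eq_zero _).2 hI, opEval_surjective A N k⟩, opEval_X A N k⟩

variable {N}

/-- An operator which kills `g ∧ X g ∧ … ∧ X ^ (k - 1) g` vanishes, if `g` generates `N`. -/
theorem opRing_eq_zero (g : N)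
    (hg : Submodule.span A (Set.range fun i : ℕ => (X : A[X]) ^ i • g) = ⊤)
    (b : opRing A N k)
    (hb : (b : Module.End A (⋀[A]^k N)) ⟨powWedge A g k, powWedge_mem A g k⟩ = 0) : b = 0 := by
  have h1 : ⋀[A]^k N ≤ (LinearMap.ker (b : Module.End A (⋀[A]^k N))).map (⋀[A]^k N).subtype := by
    -- The kernel of b is stable under the D_h because b commutes with them.
    refine exteriorPower_le_of_powWedge_mem A g hg k _ ?_ ⟨_, hb, rfl⟩
    rintro h _ ⟨w, hw, rfl⟩
    refine ⟨DRes A N k h w, ?_, rfl⟩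
    have h2 : b * ⟨DRes A N k h, DRes_mem A N k h⟩ = ⟨DRes A N k h, DRes_mem A N k h⟩ * b :=
      opRing_mul_comm A N k _ _
    have h3 := LinearMap.congr_fun (congrArg Subtype.val h2) w
    have hw' : (b : Module.End A (⋀[A]^k N)) w = 0 := hw
    change (b : Module.End A (⋀[A]^k N)) (DRes A N k h w) = 0
    refine h3.trans ?_
    change DRes A N k h ((b : Module.End A (⋀[A]^k N)) w) = 0
    rw [hw', map_zero]
  apply Subtype.ext
  refine LinearMap.ext fun α => ?_
  obtain ⟨w, hw, hwα⟩ := h1 α.2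
  rw [← Subtype.ext hwα]
  exact hw

end OpRing

/-! ### The relations D̃_m(p) hold -/

section Relations

variable {A : Type*} [CommRing A] {p : A[X]}

theorem lowCoeff_zero (hp : p.Monic) : lowCoeff p 0 = 1 := by
  simp [lowCoeff, hp]

theorem DtildeP_eq_sum (hp : p.Monic) (k m : ℕ) :
    DtildeP p k m =
      ∑ i ∈ Finset.range (m + 1), MvPolynomial.C (lowCoeff p i) * Dtilde A k (m - i) := by
  rw [DtildeP, Finset.sum_range_succ', lowCoeff_zero hp, map_one, one_mul, Nat.sub_zero, add_comm,
    Finset.range_eq_Ico, Finset.sum_Ico_add' (fun i =>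
      MvPolynomial.C (lowCoeff p i) * Dtilde A k (m - i)) 0 m 1, zero_add,
    Finset.Ico_add_one_right_eq_Icc]

theorem eq_sum_lowCoeff (p : A[X]) :
    p = ∑ i ∈ Finset.range (p.natDegree + 1), C (lowCoeff p i) * X ^ (p.natDegree - i) := by
  conv_lhs => rw [p.as_sum_range_C_mul_X_pow, ← Finset.sum_range_reflect]
  refine Finset.sum_congr rfl fun i hi => ?_
  rw [Finset.mem_range] at hi
  rw [lowCoeff, if_pos (by omega), Nat.add_sub_cancel]

variable {N : Type*} [AddCommGroup N] [Module A N] [Module A[X] N] [IsScalarTower A A[X] N]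

/-- This is `powWedge` k ∧ X^j p g = 0. The terms of p left out of the sum have exponent below k, so
the wedge kills them. -/
theorem sum_lowCoeff_powWedge (g : N) (hpg : p • g = 0) {k j : ℕ} (hk : k + 1 ≤ p.natDegree)
    (hj : j ≤ k) :
    ∑ i ∈ Finset.range (p.natDegree - k + j + 1), lowCoeff p i •
      (powWedge A g k * ExteriorAlgebra.ι A
        ((X : A[X]) ^ (k + (p.natDegree - k + j - i)) • g)) = 0 := by
  have h1 : ∑ i ∈ Finset.range (p.natDegree + 1), lowCoeff p i •
      (powWedge A g k * ExteriorAlgebra.ι A ((X : A[X]) ^ (j + (p.natDegree - i)) • g)) = 0 := by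
    have h2 : (X : A[X]) ^ j • p • g = 0 := by rw [hpg, smul_zero]
    rw [eq_sum_lowCoeff p, Finset.sum_smul, Finset.smul_sum] at h2
    have h3 := congrArg (fun x => powWedge A g k * ExteriorAlgebra.ι A x) h2
    simp only [map_sum, map_zero, mul_zero, Finset.mul_sum] at h3
    rw [← h3]
    refine Finset.sum_congr rfl fun i _ => ?_
    rw [← mul_smul_comm, ← map_smul]
    congr 2
    rw [smul_smul, ← smul_assoc]
    congr 1
    rw [smul_eq_C_mul, pow_add]
    ring
  rw [← h1]
  refine (Finset.sum_congr rfl fun i hi => ?_).trans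
    (Finset.sum_subset (Finset.range_mono (by omega)) fun i hi hi' => ?_)
  · rw [Finset.mem_range] at hi
    rw [show k + (p.natDegree - k + j - i) = j + (p.natDegree - i) by omega]
  · rw [Finset.mem_range] at hi hi'
    rw [powWedge_mul_ι_of_lt A g (by omega), smul_zero]

/-- The relations `D̃_m(p) = 0`, `n - k < m ≤ n`, hold in the operator ring. -/
theorem relIdeal_le_ker (hp : p.Monic) (g : N)
    (hg : Submodule.span A (Set.range fun i : ℕ => (X : A[X]) ^ i • g) = ⊤)
    (hpg : p • g = 0) {k : ℕ} (hk : k ≤ p.natDegree) {f : MvPolynomial (Fin k) A}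
    (hf : f ∈ relIdeal p k) : opEval A N k f = 0 := by
  suffices h : relIdeal p k ≤ RingHom.ker (opEval A N k) from h hf
  refine Ideal.span_le.2 ?_
  rintro _ ⟨j, hj1, hjk, rfl⟩
  change opEval A N k _ = 0
  obtain ⟨k, rfl⟩ : ∃ k', k = k' + 1 := ⟨k - 1, by omega⟩
  obtain ⟨j, rfl⟩ : ∃ j', j = j' + 1 := ⟨j - 1, by omega⟩
  refine opRing_eq_zero A (k + 1) g hg _ (Subtype.ext ?_)
  have h1 := sum_lowCoeff_powWedge (A := A) g hpg hk (show j ≤ k by omega)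
  rw [show p.natDegree - (k + 1) + (j + 1) = p.natDegree - k + j by omega, DtildeP_eq_sum hp]
  refine Eq.trans ?_ h1
  simp only [map_sum, map_mul, AddSubmonoidClass.coe_finsetSum, LinearMap.sum_apply]
  refine Finset.sum_congr rfl fun i _ => ?_
  rw [← D_powWedge_succ, MvPolynomial.C_eq_smul_one, map_smul, map_one, smul_mul_assoc, one_mul]
  rw [Subalgebra.coe_smul, opEval_Dtilde]
  rfl

end Relations

/-! ### Transport of operators along a change of rings -/

section BaseChange

theorem map_X_pow_smul {A S N Q : Type*} [CommRing A] [CommRing S] [AddCommGroup N] [Module A N]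
    [AddCommGroup Q] [Module A Q] [Module A[X] N] [Module S[X] Q] (F : N →ₗ[A] Q)
    (hF : ∀ m, F ((X : A[X]) • m) = (X : S[X]) • F m) (i : ℕ) (m : N) :
    F ((X : A[X]) ^ i • m) = (X : S[X]) ^ i • F m := by
  induction i with
  | zero => simp
  | succ i ih => rw [pow_succ', mul_smul, hF, ih, pow_succ', mul_smul]

variable {A S N Q : Type*} [CommRing A] [CommRing S] [Algebra A S]
  [AddCommGroup N] [Module A N] [AddCommGroup Q] [Module A Q] [Module S Q] [IsScalarTower A S Q]

/-- The homomorphism of exterior algebras induced by a linear map, along a change of rings. -/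
def exteriorMap (F : N →ₗ[A] Q) : ExteriorAlgebra A N →ₐ[A] ExteriorAlgebra S Q :=
  ExteriorAlgebra.lift A ⟨((ExteriorAlgebra.ι S).restrictScalars A).comp F,
    fun m => ExteriorAlgebra.ι_sq_zero (R := S) (F m)⟩

theorem exteriorMap_ι (F : N →ₗ[A] Q) (m : N) :
    exteriorMap (S := S) F (ExteriorAlgebra.ι A m) = ExteriorAlgebra.ι S (F m) :=
  ExteriorAlgebra.lift_ι_apply A _ _ m

variable [Module A[X] N] [Module S[X] Q]

theorem exteriorMap_powWedge (F : N →ₗ[A] Q) (hF : ∀ m, F ((X : A[X]) • m) = (X : S[X]) • F m)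
    (g : N) (j : ℕ) : exteriorMap (S := S) F (powWedge A g j) = powWedge S (F g) j := by
  induction j with
  | zero => simp [powWedge]
  | succ j ih => rw [powWedge, map_mul, ih, exteriorMap_ι, map_X_pow_smul F hF, powWedge]

variable [IsScalarTower A A[X] N] [IsScalarTower S S[X] Q]

theorem exteriorMap_D (F : N →ₗ[A] Q) (hF : ∀ m, F ((X : A[X]) • m) = (X : S[X]) • F m) (h : ℕ)
    (α : ExteriorAlgebra A N) :
    exteriorMap (S := S) F (D A N h α) = D S Q h (exteriorMap F α) := by
  induction α using ExteriorAlgebra.induction generalizing h with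
  | algebraMap a =>
    rw [D_algebraMap, AlgHom.commutes,
      IsScalarTower.algebraMap_apply A S (ExteriorAlgebra S Q), D_algebraMap]
    split_ifs
    · rw [AlgHom.commutes, IsScalarTower.algebraMap_apply A S (ExteriorAlgebra S Q)]
    · rw [map_zero]
  | ι m => rw [D_ι, exteriorMap_ι, exteriorMap_ι, D_ι, map_X_pow_smul F hF]
  | mul a b ha hb => simp only [D_mul, map_sum, map_mul, ha, hb]
  | add a b ha hb => simp only [map_add, ha, hb]

/-- A common eigenvector of the D_h with eigenvalues ψ(D̃_h) turns evaluation of f at the operators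
into the scalar ψ f. -/
theorem exteriorMap_opEval (F : N →ₗ[A] Q) (hF : ∀ m, F ((X : A[X]) • m) = (X : S[X]) • F m)
    (g : N) (k : ℕ) (ψ : MvPolynomial (Fin k) A →ₐ[A] S)
    (hD : ∀ h, D S Q h (powWedge S (F g) k) = ψ (Dtilde A k h) • powWedge S (F g) k)
    (f : MvPolynomial (Fin k) A) :
    exteriorMap (S := S) F ((opEval A N k f : Module.End A (⋀[A]^k N))
      ⟨powWedge A g k, powWedge_mem A g k⟩ : ⋀[A]^k N) = ψ f • powWedge S (F g) k := by
  induction f using MvPolynomial.induction_on with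
  | C a =>
    rw [MvPolynomial.C_eq_smul_one, map_smul, map_one, map_smul, map_one, smul_assoc, one_smul]
    change exteriorMap (S := S) F (a • powWedge A g k) = _
    rw [map_smul, exteriorMap_powWedge F hF]
  | add f f' hf hf' =>
    rw [map_add ψ, add_smul, ← hf, ← hf', ← map_add, map_add (opEval A N k)]
    rfl
  | mul_X f i hf =>
    rw [mul_comm f, map_mul, map_mul, mul_smul, smul_comm, ← Dtilde_succ, ← hD, ← map_smul, ← hf,
      ← exteriorMap_D F hF, ← coe_DRes_apply, ← opEval_Dtilde]
    rfl

theorem smul_powWedge_eq_zero (F : N →ₗ[A] Q)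
    (hF : ∀ m, F ((X : A[X]) • m) = (X : S[X]) • F m)
    (g : N) (k : ℕ) (ψ : MvPolynomial (Fin k) A →ₐ[A] S)
    (hD : ∀ h, D S Q h (powWedge S (F g) k) = ψ (Dtilde A k h) • powWedge S (F g) k)
    {f : MvPolynomial (Fin k) A} (hf : opEval A N k f = 0) :
    ψ f • powWedge S (F g) k = 0 := by
  rw [← exteriorMap_opEval F hF g k ψ hD, hf]
  simp

end BaseChange

/-! ### The degree k polynomial attached to ψ -/

section Factor

variable {A S : Type*} [CommRing A] [CommRing S] [Algebra A S] {k : ℕ}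
  (ψ : MvPolynomial (Fin k) A →ₐ[A] S)

/-- The polynomial `X ^ k - e_1 X ^ (k - 1) + … + (-1) ^ k e_k`, where `e_i` is the image
of `Δ_i` under `ψ`. -/
def factorPoly : S[X] :=
  ∑ i ∈ Finset.range (k + 1),
    C (ψ (PowerSeries.coeff i (denomSeries A k))) * X ^ (k - i)

theorem factorPoly_eq : factorPoly ψ = X ^ k + ∑ i ∈ Finset.range k,
    C (ψ (PowerSeries.coeff (i + 1) (denomSeries A k))) * X ^ (k - (i + 1)) := by
  rw [factorPoly, Finset.sum_range_succ', coeff_denomSeries_zero, map_one, map_one, one_mul,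
    Nat.sub_zero, add_comm]

theorem degree_factorPoly_tail_lt : (∑ i ∈ Finset.range k,
    C (ψ (PowerSeries.coeff (i + 1) (denomSeries A k))) * X ^ (k - (i + 1))).degree <
      (k : WithBot ℕ) := by
  refine lt_of_le_of_lt (degree_sum_le _ _) ((Finset.sup_lt_iff (WithBot.bot_lt_coe k)).2 ?_)
  intro i hi
  rw [Finset.mem_range] at hi
  exact (degree_C_mul_X_pow_le _ _).trans_lt (Nat.cast_lt.2 (by omega))

theorem factorPoly_monic : (factorPoly ψ).Monic := by
  rw [factorPoly_eq]
  exact monic_X_pow_add (degree_factorPoly_tail_lt ψ)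

theorem degree_factorPoly [Nontrivial S] : (factorPoly ψ).degree = k := by
  rw [factorPoly_eq, degree_add_eq_left_of_degree_lt, degree_X_pow]
  rw [degree_X_pow]
  exact degree_factorPoly_tail_lt ψ

theorem sum_denom_mul_DtildeP {p : A[X]} (hp : p.Monic) (m : ℕ) :
    ∑ x ∈ Finset.HasAntidiagonal.antidiagonal m,
      PowerSeries.coeff x.1 (denomSeries A k) * DtildeP p k x.2 =
        MvPolynomial.C (lowCoeff p m) := by
  have h1 : PowerSeries.mk (DtildeP p k) = PowerSeries.invOfUnit (denomSeries A k) 1 *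
      PowerSeries.mk (fun i => MvPolynomial.C (lowCoeff p i)) := by
    ext1 m
    rw [mul_comm, PowerSeries.coeff_mul, PowerSeries.coeff_mk, DtildeP_eq_sum hp,
      Finset.Nat.sum_antidiagonal_eq_sum_range_succ_mk]
    simp [Dtilde]
  have h2 : denomSeries A k * PowerSeries.mk (DtildeP p k) =
      PowerSeries.mk (fun i => MvPolynomial.C (lowCoeff p i)) := by
    rw [h1, ← mul_assoc, denomSeries_mul_inv, one_mul]
  have h3 := congrArg (PowerSeries.coeff m) h2
  simpa [PowerSeries.coeff_mul] using h3

/-- Read with reversed coefficients, the series identity of `sum_denom_mul_DtildeP` is a division of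
p. The D̃_l(p) with l ≤ n - k are the coefficients of the quotient, and the relations remove those
with n - k < l ≤ n. -/
theorem factorPoly_dvd {p : A[X]} (hp : p.Monic) (hk : k ≤ p.natDegree)
    (hψ : ∀ f ∈ relIdeal p k, ψ f = 0) : factorPoly ψ ∣ p.map (algebraMap A S) := by
  set n := p.natDegree with hn
  refine ⟨∑ l ∈ Finset.range (n - k + 1), C (ψ (DtildeP p k l)) * X ^ (n - k - l), ?_⟩
  have hzero : ∀ l, n - k < l → l ≤ n → ψ (DtildeP p k l) = 0 := fun l h1 h2 =>
    hψ _ (Ideal.subset_span ⟨l - (n - k), by omega, by omega, by congr 1; omega⟩)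
  rw [factorPoly, Finset.sum_mul_sum, ← Finset.sum_product',
    ← Finset.sum_fiberwise_of_maps_to (t := Finset.range (n + 1)) (g := fun x => x.1 + x.2)]
  · conv_lhs => rw [eq_sum_lowCoeff p]
    rw [Polynomial.map_sum]
    refine Finset.sum_congr rfl fun m hm => ?_
    rw [Finset.mem_range] at hm
    have h1 := congrArg ψ (sum_denom_mul_DtildeP (k := k) hp m)
    rw [← MvPolynomial.algebraMap_eq, AlgHom.commutes] at h1
    rw [Polynomial.map_mul, Polynomial.map_pow, map_X, map_C, ← h1, map_sum, map_sum,
      Finset.sum_mul]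
    symm
    refine (Finset.sum_congr rfl fun x hx => ?_).trans (Finset.sum_subset ?_ fun x hx hx' => ?_)
    · rw [Finset.mem_filter, Finset.mem_product, Finset.mem_range, Finset.mem_range] at hx
      rw [map_mul, map_mul, ← hn, show n - m = (k - x.1) + (n - k - x.2) by omega, pow_add]
      ring
    · intro x hx
      rw [Finset.mem_filter] at hx
      exact Finset.HasAntidiagonal.mem_antidiagonal.2 hx.2
    · rw [Finset.HasAntidiagonal.mem_antidiagonal] at hx
      rw [Finset.mem_filter, Finset.mem_product, Finset.mem_range, Finset.mem_range] at hx'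
      by_cases h2 : k < x.1
      · rw [coeff_denomSeries_of_lt A h2]
        simp
      · rw [map_mul, hzero x.2 (by omega) (by omega)]
        simp
  · intro x hx
    rw [Finset.mem_product, Finset.mem_range, Finset.mem_range] at hx
    rw [Finset.mem_range]
    omega

theorem sum_range_denom_mul_Dtilde (k h : ℕ) :
    ∑ i ∈ Finset.range (h + 2),
      PowerSeries.coeff i (denomSeries A k) * Dtilde A k (h + 1 - i) = 0 := by
  have h1 := sum_denom_mul_Dtilde A k (h + 1)
  rwa [Finset.Nat.sum_antidiagonal_eq_sum_range_succ_mk, if_neg (Nat.succ_ne_zero h)] at h1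

/-- Multiplying the equation `factorPoly ψ • g = 0` by powers of X makes the left sides satisfy the
linear recursion that defines D̃_h, with the same start at h = 0. -/
theorem powWedge_mul_ι_eq_smul {Q : Type*} [AddCommGroup Q] [Module S Q] [Module S[X] Q]
    [IsScalarTower S S[X] Q] {k : ℕ} (ψ : MvPolynomial (Fin (k + 1)) A →ₐ[A] S) (g : Q)
    (hg : factorPoly ψ • g = 0) (h : ℕ) :
    powWedge S g k * ExteriorAlgebra.ι S ((X : S[X]) ^ (k + h) • g) =
      ψ (Dtilde A (k + 1) h) • powWedge S g (k + 1) := by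
  induction h using Nat.strong_induction_on with
  | _ h ih =>
    rcases h with _ | h
    · simp [Dtilde_zero, powWedge]
    set e : ℕ → S := fun i => ψ (PowerSeries.coeff i (denomSeries A (k + 1))) with he
    have he0 : ∀ i, k + 1 < i → e i = 0 := fun i hi => by
      simp [he, coeff_denomSeries_of_lt A hi]
    set t : ℕ → ExteriorAlgebra S Q := fun i => e i •
      (powWedge S g k * ExteriorAlgebra.ι S ((X : S[X]) ^ (k + (h + 1) - i) • g)) with ht
    have h1 : ∑ i ∈ Finset.range (k + 2), t i = 0 := by
      have h2 : (X : S[X]) ^ h • factorPoly ψ • g = 0 := by rw [hg, smul_zero]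
      rw [factorPoly, Finset.sum_smul, Finset.smul_sum] at h2
      have h3 := congrArg (fun x => powWedge S g k * ExteriorAlgebra.ι S x) h2
      simp only [map_sum, map_zero, mul_zero, Finset.mul_sum] at h3
      rw [← h3]
      refine Finset.sum_congr rfl fun i hi => ?_
      rw [Finset.mem_range] at hi
      rw [ht]
      dsimp only
      rw [← mul_smul_comm, ← map_smul]
      congr 2
      rw [smul_smul, ← smul_assoc]
      congr 1
      rw [smul_eq_C_mul, show k + (h + 1) - i = h + (k + 1 - i) by omega, pow_add]
      ring
    -- Both ranges are compared inside a larger one: past k + 1 the coefficient is zero, and past h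
    -- + 1 the exponent drops below k, so the wedge vanishes.
    have h4 : ∑ i ∈ Finset.range (h + 2), t i = 0 := by
      have ha : ∑ i ∈ Finset.range (k + 2), t i = ∑ i ∈ Finset.range (h + k + 3), t i := by
        refine Finset.sum_subset (Finset.range_mono (by omega)) fun i _ hi => ?_
        rw [Finset.mem_range] at hi
        rw [ht]
        dsimp only
        rw [he0 i (by omega), zero_smul]
      rw [← h1, ha]
      refine Finset.sum_subset (Finset.range_mono (by omega)) fun i _ hi => ?_
      rw [Finset.mem_range] at hi
      rw [ht]
      dsimp only
      by_cases hik : k + 1 < i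
      · rw [he0 i hik, zero_smul]
      · rw [powWedge_mul_ι_of_lt S g (by omega), smul_zero]
    have h5 := congrArg (fun x => ψ x • powWedge S g (k + 1))
      (sum_range_denom_mul_Dtilde (A := A) (k + 1) h)
    simp only [map_zero, zero_smul, map_sum, map_mul, Finset.sum_smul, mul_smul] at h5
    rw [← h5, Finset.sum_range_succ', Finset.sum_range_succ' _ (h + 1),
      Finset.sum_congr rfl fun i hi => ?_] at h4
    · have h6 := add_left_cancel h4
      simpa [ht, he, coeff_denomSeries_zero] using h6
    · rw [Finset.mem_range] at hi
      rw [ht]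
      dsimp only
      rw [show k + (h + 1) - (i + 1) = k + (h + 1 - (i + 1)) by omega, ih _ (by omega)]

theorem D_powWedge_eq_smul {Q : Type*} [AddCommGroup Q] [Module S Q] [Module S[X] Q]
    [IsScalarTower S S[X] Q] (g : Q) (hg : factorPoly ψ • g = 0) (h : ℕ) :
    D S Q h (powWedge S g k) = ψ (Dtilde A k h) • powWedge S g k := by
  rcases k with _ | k
  · rcases h with _ | h
    · simp [Dtilde_zero, D_zero_apply]
    · have h1 := sum_range_denom_mul_Dtilde (A := A) 0 h
      rw [Finset.sum_range_succ', Finset.sum_eq_zero fun i _ => by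
        rw [coeff_denomSeries_of_lt A (Nat.succ_pos i), zero_mul], coeff_denomSeries_zero] at h1
      rw [show Dtilde A 0 (h + 1) = 0 by simpa using h1]
      simp [powWedge, D_one]
  · rw [D_powWedge_succ, powWedge_mul_ι_eq_smul ψ g hg]

end Factor

/-! ### A determinant functional on the exterior algebra of S[X]/(e) -/

section Functional

variable {S : Type*} [CommRing S]

theorem powWedge_eq_ιMulti {Q : Type*} [AddCommGroup Q] [Module S Q] [Module S[X] Q]
    (g : Q) (k : ℕ) :
    powWedge S g k = ExteriorAlgebra.ιMulti S k fun i : Fin k => (X : S[X]) ^ (i : ℕ) • g := by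
  induction k with
  | zero => simp [powWedge]
  | succ k ih =>
    rw [powWedge, ih, ExteriorAlgebra.ιMulti_apply, ExteriorAlgebra.ιMulti_apply, List.ofFn_succ']
    simp

/-- In `S[X] / (e)`, with `e` monic of degree `k`, the wedge `1 ∧ X ∧ … ∧ X ^ (k - 1)` is
linearly independent over `S`. -/
theorem eq_zero_of_smul_powWedge_eq_zero {e : S[X]} (he : e.Monic) {k : ℕ} (hk : e.degree = k)
    {c : S}
    (hc : c • powWedge S (Ideal.Quotient.mk (Ideal.span {e}) 1) k = 0) : c = 0 := by
  nontriviality S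
  let μ : (S[X] ⧸ Ideal.span {e}) →ₗ[S] S[X] := AdjoinRoot.modByMonicHom he
  have hμ : ∀ i : Fin k, μ ((X : S[X]) ^ (i : ℕ) • Ideal.Quotient.mk (Ideal.span {e}) 1) =
      X ^ (i : ℕ) := by
    intro i
    have h1 : (X : S[X]) ^ (i : ℕ) • Ideal.Quotient.mk (Ideal.span {e}) 1 =
        AdjoinRoot.mk e (X ^ (i : ℕ)) := by
      conv_rhs => rw [← mul_one ((X : S[X]) ^ (i : ℕ))]
      rfl
    rw [h1]
    refine (AdjoinRoot.modByMonicHom_mk he _).trans ?_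
    rw [modByMonic_eq_self_iff he, hk]
    exact (degree_X_pow_le _).trans_lt (Nat.cast_lt.2 i.isLt)
  -- L is the determinant of the coordinates of k vectors, read off their remainders modulo e, and
  -- zero in degrees other than k.
  let L : ExteriorAlgebra S (S[X] ⧸ Ideal.span {e}) →ₗ[S] S :=
    ExteriorAlgebra.liftAlternating (Pi.single k
      ((Matrix.detRowAlternating (R := S) (n := Fin k)).compLinearMap
        (LinearMap.pi fun i : Fin k => (lcoeff S (i : ℕ)).comp μ)))
  have hL : L (powWedge S (Ideal.Quotient.mk (Ideal.span {e}) 1) k) = 1 := by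
    rw [powWedge_eq_ιMulti]
    simp only [L, ExteriorAlgebra.liftAlternating_apply_ιMulti, Pi.single_eq_same]
    rw [AlternatingMap.compLinearMap_apply]
    have h1 : (fun i : Fin k => (LinearMap.pi fun j : Fin k => (lcoeff S (j : ℕ)).comp μ)
        ((X : S[X]) ^ (i : ℕ) • Ideal.Quotient.mk (Ideal.span {e}) 1)) =
        (1 : Matrix (Fin k) (Fin k) S) := by
      ext i j
      rw [LinearMap.pi_apply, LinearMap.comp_apply, hμ, lcoeff_apply, coeff_X_pow,
        Matrix.one_apply]
      simp [Fin.ext_iff, eq_comm]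
    exact (congrArg Matrix.det h1).trans Matrix.det_one
  have h2 := congrArg L hc
  rw [map_smul, hL, map_zero] at h2
  simpa using h2

end Functional

/-! ### M(p) as a cyclic module and its maps to S[X]/(e) -/

section ModP

open scoped Pointwise

variable {A : Type*} [CommRing A] (p : A[X])

theorem span_eps_eq_top :
    Submodule.span A (Set.range fun i : ℕ => (X : A[X]) ^ i • eps p 1 le_rfl) = ⊤ := by
  rw [eq_top_iff]
  rintro x -
  obtain ⟨⟨f, hf⟩, rfl⟩ := Submodule.Quotient.mk_surjective _ x
  obtain ⟨q, rfl⟩ := Ideal.mem_span_singleton.1 hf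
  have h1 : (Submodule.Quotient.mk ⟨X * q, hf⟩ : ModP p) = q • eps p 1 le_rfl := by
    rw [eps, ← Submodule.Quotient.mk_smul]
    congr 1
    ext1
    simp [mul_comm]
  rw [h1, q.as_sum_range_C_mul_X_pow, Finset.sum_smul]
  refine Submodule.sum_mem _ fun i _ => ?_
  rw [← smul_eq_C_mul, smul_assoc]
  exact Submodule.smul_mem _ _ (Submodule.subset_span ⟨i, rfl⟩)

theorem smul_eps : p • eps p 1 le_rfl = 0 := by
  rw [eps, ← Submodule.Quotient.mk_smul, Submodule.Quotient.mk_eq_zero]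
  exact Submodule.smul_mem_pointwise_smul _ _ _ trivial

variable {p} {S : Type*} [CommRing S] [Algebra A S] {e : S[X]}

/-- The map `X A[X] → S[X] / (e)`, `X f ↦ f`. -/
def divXMap (e : S[X]) :
    (Ideal.span {(X : A[X])} : Ideal A[X]) →ₗ[A] (S[X] ⧸ Ideal.span {e}) where
  toFun f := Ideal.Quotient.mk _ ((divX (f : A[X])).map (algebraMap A S))
  map_add' f f' := by simp [divX_add]
  map_smul' a f := by
    have : (algebraMap A S a) • Ideal.Quotient.mk (Ideal.span {e})
        ((divX (f : A[X])).map (algebraMap A S)) = a • Ideal.Quotient.mk (Ideal.span {e})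
        ((divX (f : A[X])).map (algebraMap A S)) := algebraMap_smul _ _ _
    rw [RingHom.id_apply, ← this]
    change _ = Ideal.Quotient.mk (Ideal.span {e})
      (algebraMap A S a • (divX (f : A[X])).map (algebraMap A S))
    rw [smul_eq_C_mul]
    congr 1
    simp [smul_eq_C_mul, divX_C_mul]

theorem divX_mul_of_mem (q : A[X]) {f : A[X]} (hf : f ∈ Ideal.span {(X : A[X])}) :
    divX (q * f) = q * divX f := by
  obtain ⟨r, rfl⟩ := Ideal.mem_span_singleton.1 hf
  have h : ∀ r : A[X], divX (X * r) = r := fun r => by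
    ext i
    rw [coeff_divX, coeff_X_mul]
  rw [mul_left_comm, h, h]

theorem divXMap_smul (e : S[X]) (q : A[X]) (f : (Ideal.span {(X : A[X])} : Ideal A[X])) :
    divXMap e (q • f) = q.map (algebraMap A S) • divXMap e f := by
  change Ideal.Quotient.mk _ ((divX (q * (f : A[X]))).map (algebraMap A S)) = _
  rw [divX_mul_of_mem q f.2, Polynomial.map_mul]
  rfl

/-- The map `M(p) → S[X] / (e)`, `ε^{i+1} ↦ X ^ i`, for a divisor `e` of `p` over `S`. -/
def modPMap (he : e ∣ p.map (algebraMap A S)) : ModP p →ₗ[A] (S[X] ⧸ Ideal.span {e}) :=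
  (Submodule.liftQ
    ((p • (⊤ : Submodule A[X] (Ideal.span {(X : A[X])} : Ideal A[X]))).restrictScalars A)
    (divXMap e) (by
      intro f hf
      obtain ⟨f', -, rfl⟩ := (Submodule.mem_smul_pointwise_iff_exists _ _ _).1 hf
      obtain ⟨r, hr⟩ := he
      rw [LinearMap.mem_ker, divXMap_smul, hr, mul_comm, mul_smul]
      change r • Ideal.Quotient.mk _ (e * _) = 0
      rw [Ideal.Quotient.eq_zero_iff_mem.2 (Ideal.mul_mem_right _ _
        (Ideal.mem_span_singleton_self e)), smul_zero])).comp
    (Submodule.Quotient.restrictScalarsEquiv A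
      (p • (⊤ : Submodule A[X] (Ideal.span {(X : A[X])} : Ideal A[X])))).symm.toLinearMap

theorem modPMap_mk (he : e ∣ p.map (algebraMap A S))
    (f : (Ideal.span {(X : A[X])} : Ideal A[X])) :
    modPMap he (Submodule.Quotient.mk f) = divXMap e f := rfl

theorem modPMap_X_smul (he : e ∣ p.map (algebraMap A S)) (m : ModP p) :
    modPMap he ((X : A[X]) • m) = (X : S[X]) • modPMap he m := by
  obtain ⟨f, rfl⟩ := Submodule.Quotient.mk_surjective _ m
  rw [← Submodule.Quotient.mk_smul, modPMap_mk, modPMap_mk, divXMap_smul, map_X]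

theorem modPMap_eps (he : e ∣ p.map (algebraMap A S)) :
    modPMap he (eps p 1 le_rfl) = Ideal.Quotient.mk _ 1 := by
  rw [eps, modPMap_mk]
  change Ideal.Quotient.mk _ ((divX ((X : A[X]) ^ 1)).map (algebraMap A S)) = _
  rw [divX_X_pow]
  simp

/-- If `p` is divisible over `S` by the polynomial of degree `k` attached to `ψ`, then `ψ`
factors through the operator ring of `⋀^k M(p)`. -/
theorem eq_zero_of_opEval_eq_zero {k : ℕ} (ψ : MvPolynomial (Fin k) A →ₐ[A] S)
    (hψ : factorPoly ψ ∣ p.map (algebraMap A S)) {f : MvPolynomial (Fin k) A}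
    (hf : opEval A (ModP p) k f = 0) : ψ f = 0 := by
  nontriviality S
  refine eq_zero_of_smul_powWedge_eq_zero (factorPoly_monic ψ) (degree_factorPoly ψ) ?_
  have hg : factorPoly ψ • modPMap hψ (eps p 1 le_rfl) = 0 := by
    rw [modPMap_eps]
    change Ideal.Quotient.mk _ (factorPoly ψ * 1) = 0
    rw [mul_one]
    exact Ideal.Quotient.eq_zero_iff_mem.2 (Ideal.mem_span_singleton_self _)
  have h1 := smul_powWedge_eq_zero (modPMap hψ) (modPMap_X_smul hψ) (eps p 1 le_rfl) k ψ
    (D_powWedge_eq_smul ψ _ hg) hf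
  rwa [modPMap_eps] at h1

end ModP

end SchubertCalculus

end

theorem mainTheorem1 {A : Type*} [CommRing A] (p : Polynomial A) (hp : p.Monic)
    (k : ℕ) (hk : k ≤ p.natDegree) :
    (∃ Ψ : MvPolynomial (Fin k) A ≃ₐ[A] SchubertCalculus.OperatorRing (0 : Polynomial A) k,
      ∀ i : Fin k,
        (Ψ (MvPolynomial.X i) :
            Module.End A (⋀[A]^k (SchubertCalculus.ModP (0 : Polynomial A)))) =
          SchubertCalculus.DRes A (SchubertCalculus.ModP (0 : Polynomial A)) k ((i : ℕ) + 1)) ∧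
    (∃ Φ : (MvPolynomial (Fin k) A ⧸ SchubertCalculus.relIdeal p k) ≃ₐ[A]
        SchubertCalculus.OperatorRing p k,
      ∀ i : Fin k,
        (Φ (Ideal.Quotient.mk (SchubertCalculus.relIdeal p k) (MvPolynomial.X i)) :
            Module.End A (⋀[A]^k (SchubertCalculus.ModP p))) =
          SchubertCalculus.DRes A (SchubertCalculus.ModP p) k ((i : ℕ) + 1)) := by
  open SchubertCalculus in
  exact ⟨exists_equiv_opRing A (ModP (0 : A[X])) k fun f hf =>
      -- The divisibility condition is vacuous here: every polynomial divides 0.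
      eq_zero_of_opEval_eq_zero (AlgHom.id A (MvPolynomial (Fin k) A)) (by simp) hf,
    exists_quotient_equiv_opRing A (ModP p) k (relIdeal p k) fun f =>
      ⟨relIdeal_le_ker hp (eps p 1 le_rfl) (span_eps_eq_top p) (smul_eps p) hk, fun hf =>
        -- With S the quotient by the relations, the vanishing of ψ f says that f lies in `relIdeal
        -- p k`.
        Ideal.Quotient.eq_zero_iff_mem.1 (eq_zero_of_opEval_eq_zero
          (Ideal.Quotient.mkₐ A (relIdeal p k))
          (factorPoly_dvd _ hp hk fun f hf => Ideal.Quotient.eq_zero_iff_mem.2 hf) hf)⟩⟩
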